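/- Let $(\Omega,\mathcal A,\mathbb P)$ be a (complete) probability space and let $(S,\mathcal S,\mu)$ be a $\sigma$-finite measure space with the approximation-by-averaging property: for every $n\in\mathbb N$ there is an at most countable family $\mathfrak B_n$ of pairwise disjoint measurable subsets of $S$ of positive finite measure such that, for every real Banach space $E$, all $p\in[1,\infty)$ and every $f\in L^p(S;E)$, the functions $f_n=\sum_{B\in\mathfrak B_n}\mathbf 1_B\,\mu(B)^{-1}\int_B f\,\mathrm d\mu$ converge to $f$ in $L^p(S;E)$. Let $q\in(1,2)$, $p\in[1,q]$, $\widetilde q\in[q,\infty)$, $\widehat q:=\min\{\widetilde q,2\}$, and $X\in L^1(\Omega;L^p(S))$. For every $\ell\in\mathbb N=\{1,2,\dots\}$ let $X_\ell\in L^{\widetilde q}(\Omega;L^p(S))\cap L^p(S;L^{\widetilde q}(\Omega))$, set $X_0:=0$ and $\xi_\ell:=X_\ell-X_{\ell-1}$, and let $\mathcal C_\ell$ denote the cost of generating one sample of $\xi_\ell$. (An $L^p(S)$-valued random variable $\eta$ belongs to $L^p(S;L^{r}(\Omega))$ if it has a jointly measurable version $\widetilde\eta\colon S\times\Omega\to\mathbb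 R$, with $\eta(\omega)=\widetilde\eta(\cdot,\omega)$ in $L^p(S)$ for a.e. $\omega$, such that $s\mapsto\widetilde\eta(s,\cdot)$ is in $L^p(S;L^{r}(\Omega))$; its norm is the norm of this map.) Suppose that there are a function $\beta\colon[q,\widehat q]\to(0,\infty)$, constants $\alpha,\gamma,C_\alpha,C_\beta,C_\gamma,c_1,c_2\in(0,\infty)$, $A\in(1,\infty)$ and real numbers $(N_\ell)_{\ell\in\mathbb N}$ with $c_1A^\ell\le N_\ell\le c_2A^\ell$ such that, for all $\ell\in\mathbb N$, $$\|\mathbb E[X]-\mathbb E[X_\ell]\|_{L^p(S)}\le C_\alpha N_\ell^{-\alpha},\qquad \mathcal C_\ell\le C_\gamma N_\ell^{\gamma},$$ $$\|X_\ell-\mathbb E[X_\ell]-(X_{\ell-1}-\mathbb E[X_{\ell-1}])\|_{L^p(S;L^r(\Omega))}\le C_\beta N_\ell^{-\beta(r)}\quad\text{for all } r\in[q,\widehat q].$$ For each $\ell\in\mathbb N$ let $(\xi_{\ell,j})_{j\in\mathbb N}\subset L^{\widetilde q}(\Omega;L^p(S))\cap L^p(S;L^{\widetilde q}(\Omega))$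 be a sequence of independent copies of $\xi_\ell$. Then, for every $r\in[q,\widehat q]$, with $r':=\frac{r}{r-1}$, there is a constant $K\in(0,\infty)$, depending only on $p,q,\widetilde q,r,\alpha,\beta,\gamma,C_\alpha,C_\beta,C_\gamma,A,c_1,c_2$, such that for every $\epsilon\in(0,\frac12]$ there exist $L\in\mathbb N$ and $M_1,\dots,M_L\in\mathbb N$ with $$\Bigl\|\mathbb E[X]-\sum_{\ell=1}^L\frac1{M_\ell}\sum_{j=1}^{M_\ell}\xi_{\ell,j}\Bigr\|_{L^q(\Omega;L^p(S))}<\epsilon$$ and computational cost $$\sum_{\ell=1}^L\mathcal C_\ell M_\ell\le K\cdot\begin{cases}\epsilon^{-\gamma/\alpha}+\epsilon^{-r'}&\text{if }\beta(r)>\gamma/r',\\ \epsilon^{-\gamma/\alpha}+\epsilon^{-r'}|\log_A\epsilon|^{r'+1}&\text{if }\beta(r)=\gamma/r',\\ \epsilon^{-\gamma/\alpha}+\epsilon^{-r'-(\gamma-\beta(r)r')/\alpha}&\text{if }\beta(r)<\gamma/r'.\end{cases}$$ -/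

import Mathlib

open MeasureTheory ProbabilityTheory Filter Topology
open scoped ENNReal

universe u v

noncomputable section

namespace MLMC

/-- The function `∑_{B ∈ 𝔅} 1_B (μ(B)⁻¹ ∫_B f dμ)`. For a pairwise disjoint family `𝔅`, at most
one term of the sum is nonzero at each point. -/
def averaging {S : Type u} [MeasurableSpace S] (μ : Measure S) (𝔅 : Set (Set S))
    {E : Type v} [NormedAddCommGroup E] [NormedSpace ℝ E] (f : S → E) : S → E :=
  fun s => ∑' B : 𝔅, (B : Set S).indicator (fun _ => ⨍ t in (B : Set S), f t ∂μ) s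

/-- The approximation-by-averaging property of a measure space: there are countable families
`𝔅 n` of pairwise disjoint measurable sets of positive finite measure such that, for every Banach
space `E`, every `p ∈ [1, ∞)` and every `f ∈ L^p(S; E)`, the averages of `f` over `𝔅 n` converge
to `f` in `L^p(S; E)`. -/
def ApproxByAveraging {S : Type u} [MeasurableSpace S] (μ : Measure S) : Prop :=
  ∃ 𝔅 : ℕ → Set (Set S),
    (∀ n, (𝔅 n).Countable ∧ (𝔅 n).PairwiseDisjoint id ∧
      ∀ B ∈ 𝔅 n, MeasurableSet B ∧ 0 < μ B ∧ μ B < ∞) ∧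
    ∀ (E : Type v) [NormedAddCommGroup E] [NormedSpace ℝ E] [CompleteSpace E]
      (p : ℝ≥0∞), 1 ≤ p → p ≠ ∞ → ∀ f : S → E, MemLp f p μ →
        Tendsto (fun n => eLpNorm (f - averaging μ (𝔅 n) f) p μ) atTop (𝓝 0)

section Swapped

variable {S : Type u} [MeasurableSpace S] {μ : Measure S}
  {Ω : Type v} [MeasurableSpace Ω] {p : ℝ≥0∞}

/-- `Y` is a measurable function on the product space with `η(ω) = Y(·, ω)` in `L^p(S)` for
almost every `ω`. -/
def IsJointVersion (P : Measure Ω) (η : Ω → Lp ℝ p μ) (Y : S × Ω → ℝ) : Prop :=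
  Measurable Y ∧ ∀ᵐ ω ∂P, η ω =ᵐ[μ] fun s => Y (s, ω)

/-- The `L^p(S)`-valued random variable `η` corresponds to the element `g` of the Bochner space
`L^p(S; L^q(Ω))`: there is a jointly measurable version `Y` of `η` with `g(s) = Y(s, ·)` in
`L^q(Ω)` for almost every `s`. Such a `g` is unique almost everywhere. -/
def IsSwap (P : Measure Ω) (q : ℝ≥0∞) [Fact (1 ≤ q)] (η : Ω → Lp ℝ p μ)
    (g : S → Lp ℝ q P) : Prop :=
  MemLp g p μ ∧ ∃ Y : S × Ω → ℝ, IsJointVersion P η Y ∧ ∀ᵐ s ∂μ, g s =ᵐ[P] fun ω => Y (s, ω)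

/-- `η ∈ L^p(S; L^q(Ω))`, with `q ∈ [1, ∞]`. -/
def MemSwap (P : Measure Ω) (q : ℝ≥0∞) (η : Ω → Lp ℝ p μ) : Prop :=
  ∃ _ : Fact (1 ≤ q), ∃ g : S → Lp ℝ q P, IsSwap P q η g

/-- The norm of `η` in `L^p(S; L^q(Ω))`, with value `∞` if `η` is not in this space. -/
def swapNorm (P : Measure Ω) (q : ℝ≥0∞) (η : Ω → Lp ℝ p μ) : ℝ≥0∞ :=
  ⨅ (_ : Fact (1 ≤ q)) (g : S → Lp ℝ q P) (_ : IsSwap P q η g), eLpNorm g p μ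

end Swapped

/-- The multilevel Monte Carlo estimator `∑_{ℓ=1}^L (1/M_ℓ) ∑_j ξ_{ℓ,j}`, using `M_ℓ` samples on
level `ℓ` (samples are numbered from `0`). -/
def estimator {Ω : Type v} {V : Type u} [AddCommGroup V] [Module ℝ V]
    (ξ : ℕ → ℕ → Ω → V) (L : ℕ) (M : ℕ → ℕ) (ω : Ω) : V :=
  ∑ l ∈ Finset.Icc 1 L, (1 / (M l : ℝ)) • ∑ j ∈ Finset.range (M l), ξ l j ω

/-- The cost of the estimator, where `cost ℓ` is the cost of one sample on level `ℓ`. -/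
def totalCost (cost : ℕ → ℝ) (L : ℕ) (M : ℕ → ℕ) : ℝ :=
  ∑ l ∈ Finset.Icc 1 L, cost l * (M l : ℝ)

/-- The order of the cost in terms of the accuracy `ε`, where `b` is the strong rate and `r'` the
exponent conjugate to the integrability parameter. -/
def costOrder (α b γ A r' ε : ℝ) : ℝ :=
  if γ / r' < b then
    ε ^ (-(γ / α)) + ε ^ (-r')
  else if b = γ / r' then
    ε ^ (-(γ / α)) + ε ^ (-r') * |Real.logb A ε| ^ (r' + 1)
  else
    ε ^ (-(γ / α)) + ε ^ (-r' - (γ - b * r') / α)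

end MLMC

end

/-!
For independent centred copies `U₁, …, U_M` of a scalar `V` and `1 ≤ r ≤ 2`, von Bahr and Esseen's
inequality bounds `‖U₁ + ⋯ + U_M‖_r` by `(2 M)^(1/r) ‖V‖_r`: Jensen's inequality for the conditional
expectation gives `‖X‖_r ≤ ‖X - Y‖_r` for independent `X` and centred `Y`, and this is combined with
`‖X + Y‖_r^r + ‖X - Y‖_r^r ≤ 2 (‖X‖_r^r + ‖Y‖_r^r)`.

A bound `‖Φ ∘ η‖_q ≤ C ‖Φ ∘ η₀‖_q` for all functionals `Φ` on `L^p(S)` passes to the norms of `η`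
and `η₀` in `L^p(S; L^q(Ω))`. Indeed, let `g` and `g₀` be the corresponding maps on `S`. The
integral of `(g, g₀)` over a set `B` of finite measure is the pair `(Φ ∘ η, Φ ∘ η₀)` with `Φ = ∫_B`,
so `(g s, g₀ s)` lies in the closed span of such pairs, where the bound persists, for almost every
`s`. Minkowski's integral inequality then compares `L^p(S; L^r(Ω))` with `L^r(Ω; L^p(S))`, and
level `ℓ` contributes an error of order `A^(-bℓ) M_ℓ^(-1/r')`, where `b = β(r)`.

The number of levels is fixed by the bias. Minimising the cost `∑ A^(γℓ) M_ℓ` for a prescribed error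
gives `M_ℓ` proportional to `A^(-ℓ(b + γ)/(1 + 1/r'))`, and the total cost becomes
`∑ A^(γℓ) + ε^(-r') (∑ A^(ℓ(γ - b r')/(r' + 1)))^(r' + 1)`; the sign of `γ - b r'` decides between
the three regimes of the second geometric sum.
-/

noncomputable section

namespace MLMC

section VonBahrEsseen

lemma norm_add_rpow_add_norm_sub_rpow_le {E : Type*} [NormedAddCommGroup E]
    [InnerProductSpace ℝ E] {t : ℝ} (ht0 : 0 ≤ t) (ht2 : t ≤ 2) (a b : E) :
    ‖a + b‖ ^ t + ‖a - b‖ ^ t ≤ 2 * (‖a‖ ^ t + ‖b‖ ^ t) := by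
  have hθ0 : 0 ≤ t / 2 := by positivity
  have hθ1 : t / 2 ≤ 1 := by linarith
  have sq_rpow (x : E) : (‖x‖ ^ 2) ^ (t / 2) = ‖x‖ ^ t := by
    rw [← Real.rpow_natCast_mul (norm_nonneg x)]
    congr 1
    push_cast
    ring
  have hconcave := (Real.concaveOn_rpow hθ0 hθ1).2 (sq_nonneg ‖a + b‖) (sq_nonneg ‖a - b‖)
    (by norm_num : (0 : ℝ) ≤ 1 / 2) (by norm_num : (0 : ℝ) ≤ 1 / 2) (by norm_num)
  have hmean : (1 / 2 : ℝ) * ‖a + b‖ ^ 2 + 1 / 2 * ‖a - b‖ ^ 2 = ‖a‖ ^ 2 + ‖b‖ ^ 2 := by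
    linarith [parallelogram_law_with_norm ℝ a b]
  have hsubadd := Real.rpow_add_le_add_rpow (sq_nonneg ‖a‖) (sq_nonneg ‖b‖) hθ0 hθ1
  simp only [smul_eq_mul, hmean, sq_rpow] at hconcave hsubadd
  linarith

lemma enorm_add_rpow_add_enorm_sub_rpow_le {E : Type*} [NormedAddCommGroup E]
    [InnerProductSpace ℝ E] {t : ℝ} (ht0 : 0 ≤ t) (ht2 : t ≤ 2) (a b : E) :
    ‖a + b‖ₑ ^ t + ‖a - b‖ₑ ^ t ≤ 2 * (‖a‖ₑ ^ t + ‖b‖ₑ ^ t) := by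
  have h := ENNReal.ofReal_le_ofReal (norm_add_rpow_add_norm_sub_rpow_le ht0 ht2 a b)
  rw [ENNReal.ofReal_mul zero_le_two, ENNReal.ofReal_add (by positivity) (by positivity),
    ENNReal.ofReal_add (by positivity) (by positivity)] at h
  simpa only [← ENNReal.ofReal_rpow_of_nonneg (norm_nonneg _) ht0, ofReal_norm,
    ENNReal.ofReal_ofNat] using h

variable {Ω : Type*} [MeasurableSpace Ω] {P : Measure Ω} {t : ℝ}

lemma eLpNorm_ofReal_rpow_eq_lintegral {E : Type*} [ENorm E] (ht : 0 < t) (X : Ω → E) :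
    eLpNorm X (ENNReal.ofReal t) P ^ t = ∫⁻ ω, ‖X ω‖ₑ ^ t ∂P := by
  have h := eLpNorm_nnreal_pow_eq_lintegral (f := X) (μ := P) (Real.toNNReal_pos.2 ht).ne'
  rwa [Real.coe_toNNReal _ ht.le] at h

variable [IsProbabilityMeasure P] {E : Type*} [NormedAddCommGroup E] [MeasurableSpace E]
  [BorelSpace E] [SecondCountableTopology E]

lemma eLpNorm_le_eLpNorm_sub_of_indepFun [NormedSpace ℝ E] [CompleteSpace E] {X Y : Ω → E}
    {p : ℝ≥0∞} (hp : 1 ≤ p) (hX : Integrable X P) (hY : Integrable Y P)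
    (hindep : IndepFun X Y P) (hmean : ∫ ω, Y ω ∂P = 0) :
    eLpNorm X p P ≤ eLpNorm (X - Y) p P := by
  obtain ⟨X', hX', hXX'⟩ := hX.1
  obtain ⟨Y', hY', hYY'⟩ := hY.1
  have hX'_condExp : P[X' | MeasurableSpace.comap X' inferInstance] = X' :=
    condExp_of_stronglyMeasurable hX'.measurable.comap_le
      (comap_measurable X').stronglyMeasurable (hX.congr hXX')
  have hY'_condExp : P[Y' | MeasurableSpace.comap X' inferInstance] =ᵐ[P] 0 := by
    refine (condExp_indep_eq hY'.measurable.comap_le hX'.measurable.comap_le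
      (comap_measurable Y').stronglyMeasurable
      ((IndepFun_iff_Indep Y' X' P).1 (hindep.congr hXX' hYY').symm)).trans (.of_eq ?_)
    rw [← integral_congr_ae hYY', hmean]
    rfl
  have hcondExp : P[X' - Y' | MeasurableSpace.comap X' inferInstance] =ᵐ[P] X' := by
    filter_upwards [condExp_sub (hX.congr hXX') (hY.congr hYY')
      (MeasurableSpace.comap X' inferInstance), hY'_condExp] with ω hsub hzero
    simp [hsub, hX'_condExp, hzero]
  calc eLpNorm X p P
    _ = eLpNorm P[X' - Y' | MeasurableSpace.comap X' inferInstance] p P :=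
        eLpNorm_congr_ae (hXX'.trans hcondExp.symm)
    _ ≤ eLpNorm (X' - Y') p P := eLpNorm_condExp_le_eLpNorm _ hp
    _ = eLpNorm (X - Y) p P := eLpNorm_congr_ae (hXX'.sub hYY').symm

variable [InnerProductSpace ℝ E] [CompleteSpace E]

lemma eLpNorm_add_rpow_le_of_indepFun (ht1 : 1 ≤ t) (ht2 : t ≤ 2) {X Y : Ω → E}
    (hX : MemLp X (ENNReal.ofReal t) P) (hY : MemLp Y (ENNReal.ofReal t) P)
    (hindep : IndepFun X Y P) (hmean : ∫ ω, Y ω ∂P = 0) :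
    eLpNorm (X + Y) (ENNReal.ofReal t) P ^ t ≤
      eLpNorm X (ENNReal.ofReal t) P ^ t + 2 * eLpNorm Y (ENNReal.ofReal t) P ^ t := by
  have ht0 : 0 < t := by linarith
  have hp : 1 ≤ ENNReal.ofReal t := ENNReal.one_le_ofReal.2 ht1
  have hclarkson : eLpNorm (X + Y) (ENNReal.ofReal t) P ^ t +
      eLpNorm (X - Y) (ENNReal.ofReal t) P ^ t ≤
      2 * (eLpNorm X (ENNReal.ofReal t) P ^ t + eLpNorm Y (ENNReal.ofReal t) P ^ t) := by
    simp only [eLpNorm_ofReal_rpow_eq_lintegral ht0]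
    rw [← lintegral_add_left' ((hX.1.add hY.1).enorm.pow_const t),
      ← lintegral_add_left' (hX.1.enorm.pow_const t),
      ← lintegral_const_mul' _ _ ENNReal.ofNat_ne_top]
    exact lintegral_mono fun ω => enorm_add_rpow_add_enorm_sub_rpow_le ht0.le ht2 (X ω) (Y ω)
  have hjensen : eLpNorm X (ENNReal.ofReal t) P ^ t ≤
      eLpNorm (X - Y) (ENNReal.ofReal t) P ^ t := by
    gcongr
    exact eLpNorm_le_eLpNorm_sub_of_indepFun hp (hX.integrable hp) (hY.integrable hp) hindep hmean
  refine ENNReal.le_of_add_le_add_right (ENNReal.rpow_ne_top_of_nonneg ht0.le hX.2.ne) ?_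
  calc _ ≤ _ := add_le_add_right hjensen _
    _ ≤ _ := hclarkson
    _ = _ := by ring

theorem eLpNorm_sum_rpow_le_of_iIndepFun (ht1 : 1 ≤ t) (ht2 : t ≤ 2) {ι : Type*} {U : ι → Ω → E}
    (hU : ∀ i, MemLp (U i) (ENNReal.ofReal t) P) (hindep : iIndepFun U P)
    (hmean : ∀ i, ∫ ω, U i ω ∂P = 0) (s : Finset ι) :
    eLpNorm (∑ i ∈ s, U i) (ENNReal.ofReal t) P ^ t ≤
      2 * ∑ i ∈ s, eLpNorm (U i) (ENNReal.ofReal t) P ^ t := by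
  classical
  induction s using Finset.induction_on with
  | empty => simp [ENNReal.zero_rpow_of_pos (by linarith : 0 < t)]
  | insert i s hi ih =>
    rw [Finset.sum_insert hi, Finset.sum_insert hi, add_comm (U i)]
    have hS : MemLp (∑ j ∈ s, U j) (ENNReal.ofReal t) P := memLp_finsetSum' s fun j _ => hU j
    have hSi : IndepFun (∑ j ∈ s, U j) (U i) P :=
      hindep.indepFun_finsetSum_of_notMem₀ (fun j => (hU j).1.aemeasurable) hi
    refine (eLpNorm_add_rpow_le_of_indepFun ht1 ht2 hS (hU i) hSi (hmean i)).trans ?_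
    rw [mul_add, add_comm]
    gcongr

lemma eLpNorm_sum_le_of_identDistrib (ht1 : 1 ≤ t) (ht2 : t ≤ 2) {Ω' : Type*}
    [MeasurableSpace Ω'] {P' : Measure Ω'} {U : ℕ → Ω → E} {V : Ω' → E}
    (hindep : iIndepFun U P) (hident : ∀ j, IdentDistrib (U j) V P P')
    (hmean : ∫ ω, V ω ∂P' = 0) {m : ℕ} (hm : m ≠ 0) :
    eLpNorm (∑ j ∈ Finset.range m, U j) (ENNReal.ofReal t) P ≤
      ENNReal.ofReal ((2 * m) ^ t⁻¹) * eLpNorm V (ENNReal.ofReal t) P' := by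
  have ht0 : 0 < t := by linarith
  by_cases hV : eLpNorm V (ENNReal.ofReal t) P' = ∞
  · rw [hV, ENNReal.mul_top (ENNReal.ofReal_ne_zero_iff.2 (by positivity))]
    exact le_top
  have hU (j : ℕ) : MemLp (U j) (ENNReal.ofReal t) P :=
    ⟨(hident j).aemeasurable_fst.aestronglyMeasurable, by
      rw [(hident j).eLpNorm_eq]; exact lt_top_iff_ne_top.2 hV⟩
  have hsum := eLpNorm_sum_rpow_le_of_iIndepFun ht1 ht2 hU hindep
    (fun j => (hident j).integral_eq.trans hmean) (Finset.range m)
  simp only [(hident _).eLpNorm_eq, Finset.sum_const, Finset.card_range, nsmul_eq_mul,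
    ← mul_assoc] at hsum
  rw [← ENNReal.le_rpow_inv_iff ht0, ENNReal.mul_rpow_of_nonneg _ _ (inv_nonneg.2 ht0.le),
    ENNReal.rpow_rpow_inv ht0.ne'] at hsum
  refine hsum.trans_eq ?_
  rw [← ENNReal.ofReal_rpow_of_nonneg (by positivity) (by positivity),
    ENNReal.ofReal_mul zero_le_two]
  simp

end VonBahrEsseen

section Minkowski

variable {α β : Type*} [MeasurableSpace α] [MeasurableSpace β] {μ : Measure α} {ν : Measure β}
  {k l : ℝ} {H T : β → ℝ≥0∞} {R : ℝ≥0∞}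

lemma lintegral_rpow_rpow_inv_le_of_le_of_forall_lintegral_mul_le (hkl : k.HolderConjugate l)
    (hT : Measurable T) (hTH : T ≤ H) (hT_ne_top : ∫⁻ b, T b ^ k ∂ν ≠ ∞)
    (hH : ∀ w : β → ℝ≥0∞, Measurable w → ∫⁻ b, w b * H b ∂ν ≤ (∫⁻ b, w b ^ l ∂ν) ^ l⁻¹ * R) :
    (∫⁻ b, T b ^ k ∂ν) ^ k⁻¹ ≤ R := by
  set I := ∫⁻ b, T b ^ k ∂ν
  rcases eq_or_ne I 0 with h0 | h0
  · simp [h0, ENNReal.zero_rpow_of_pos (inv_pos.2 hkl.pos)]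
  -- Testing against the extremal weight `T ^ (k - 1)`.
  have htest : I ≤ I ^ l⁻¹ * R := by
    have hw := hH (fun b => T b ^ (k - 1)) (hT.pow_const _)
    simp only [← ENNReal.rpow_mul, hkl.sub_one_mul_conj] at hw
    refine le_trans (lintegral_mono fun b => ?_) hw
    calc T b ^ k = T b ^ (k - 1) * T b ^ (1 : ℝ) := by
          rw [← ENNReal.rpow_add_of_nonneg _ _ hkl.sub_one_pos.le zero_le_one, sub_add_cancel]
      _ ≤ T b ^ (k - 1) * H b := by
          rw [ENNReal.rpow_one]
          gcongr
          exact hTH b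
  have hsplit : I = I ^ l⁻¹ * I ^ k⁻¹ := by
    rw [← ENNReal.rpow_add _ _ h0 hT_ne_top, hkl.symm.inv_add_inv_eq_one, ENNReal.rpow_one]
  nth_rewrite 1 [hsplit] at htest
  exact (ENNReal.mul_le_mul_iff_right (ENNReal.rpow_pos (pos_iff_ne_zero.2 h0) hT_ne_top).ne'
    (ENNReal.rpow_ne_top_of_ne_zero h0 hT_ne_top)).1 htest

lemma lintegral_rpow_rpow_inv_le_of_forall_lintegral_mul_le [SigmaFinite ν]
    (hkl : k.HolderConjugate l) (hH_meas : Measurable H)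
    (hH : ∀ w : β → ℝ≥0∞, Measurable w → ∫⁻ b, w b * H b ∂ν ≤ (∫⁻ b, w b ^ l ∂ν) ^ l⁻¹ * R) :
    (∫⁻ b, H b ^ k ∂ν) ^ k⁻¹ ≤ R := by
  let T (n : ℕ) : β → ℝ≥0∞ := (spanningSets ν n).indicator fun b => min (H b) n
  have hT_meas (n : ℕ) : Measurable (T n) :=
    (hH_meas.min measurable_const).indicator (measurableSet_spanningSets ν n)
  have hT_le (n : ℕ) : T n ≤ H :=
    Set.indicator_le' (fun _ _ => min_le_left _ _) fun _ _ => zero_le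
  have hT_ne_top (n : ℕ) : ∫⁻ b, T n b ^ k ∂ν ≠ ∞ := by
    refine ne_top_of_le_ne_top (b := (n : ℝ≥0∞) ^ k * ν (spanningSets ν n))
      (ENNReal.mul_ne_top (ENNReal.rpow_ne_top_of_nonneg hkl.nonneg (by simp))
        (measure_spanningSets_lt_top ν n).ne) ?_
    rw [← lintegral_indicator_const (measurableSet_spanningSets ν n)]
    refine lintegral_mono fun b => ?_
    by_cases hb : b ∈ spanningSets ν n
    · rw [Set.indicator_of_mem hb]
      exact ENNReal.rpow_le_rpow ((Set.indicator_of_mem hb _).trans_le (min_le_right _ _))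
        hkl.nonneg
    · simp [T, hb, ENNReal.zero_rpow_of_pos hkl.pos]
  have hT_tendsto (b : β) : Tendsto (fun n => T n b ^ k) atTop (𝓝 (H b ^ k)) := by
    refine (ENNReal.continuous_rpow_const.tendsto _).comp ?_
    have hmin : Tendsto (fun n : ℕ => min (H b) n) atTop (𝓝 (min (H b) ∞)) :=
      tendsto_const_nhds.min ENNReal.tendsto_nat_nhds_top
    rw [min_eq_left le_top] at hmin
    refine hmin.congr' ?_
    filter_upwards [eventually_ge_atTop (spanningSetsIndex ν b)] with n hn
    simp only [T, Set.indicator_of_mem (mem_spanningSets_of_index_le ν b hn)]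
  rw [ENNReal.rpow_inv_le_iff hkl.pos]
  calc ∫⁻ b, H b ^ k ∂ν
    _ = ∫⁻ b, liminf (fun n => T n b ^ k) atTop ∂ν :=
        lintegral_congr fun b => (hT_tendsto b).liminf_eq.symm
    _ ≤ liminf (fun n => ∫⁻ b, T n b ^ k ∂ν) atTop :=
        lintegral_liminf_le fun n => (hT_meas n).pow_const _
    _ ≤ R ^ k := liminf_le_of_frequently_le' <| .of_forall fun n =>
        (ENNReal.rpow_inv_le_iff hkl.pos).1 <|
          lintegral_rpow_rpow_inv_le_of_le_of_forall_lintegral_mul_le hkl (hT_meas n) (hT_le n)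
            (hT_ne_top n) hH

lemma lintegral_mul_lintegral_le [SFinite μ] [SFinite ν] (hkl : k.HolderConjugate l)
    {F : α → β → ℝ≥0∞} (hF : Measurable (Function.uncurry F)) {w : β → ℝ≥0∞}
    (hw : Measurable w) :
    ∫⁻ b, w b * ∫⁻ a, F a b ∂μ ∂ν ≤
      (∫⁻ b, w b ^ l ∂ν) ^ l⁻¹ * ∫⁻ a, (∫⁻ b, F a b ^ k ∂ν) ^ k⁻¹ ∂μ := by
  have hF_k : Measurable fun a => (∫⁻ b, F a b ^ k ∂ν) ^ k⁻¹ :=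
    (hF.pow_const k).lintegral_prod_right.pow_const _
  calc ∫⁻ b, w b * ∫⁻ a, F a b ∂μ ∂ν
    _ = ∫⁻ b, ∫⁻ a, w b * F a b ∂μ ∂ν :=
        lintegral_congr fun b => (lintegral_const_mul _ (by fun_prop)).symm
    _ = ∫⁻ a, ∫⁻ b, w b * F a b ∂ν ∂μ :=
        (lintegral_lintegral_swap ((hw.comp measurable_snd).mul hF).aemeasurable).symm
    _ ≤ ∫⁻ a, (∫⁻ b, w b ^ l ∂ν) ^ l⁻¹ * (∫⁻ b, F a b ^ k ∂ν) ^ k⁻¹ ∂μ := by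
        refine lintegral_mono fun a => ?_
        simpa only [one_div, Pi.mul_apply] using ENNReal.lintegral_mul_le_Lp_mul_Lq ν hkl.symm
          hw.aemeasurable (by fun_prop : Measurable fun b => F a b).aemeasurable
    _ = _ := lintegral_const_mul _ hF_k

theorem lintegral_lintegral_rpow_rpow_inv_le [SFinite μ] [SigmaFinite ν] (hk : 1 ≤ k)
    {F : α → β → ℝ≥0∞} (hF : Measurable (Function.uncurry F)) :
    (∫⁻ b, (∫⁻ a, F a b ∂μ) ^ k ∂ν) ^ k⁻¹ ≤ ∫⁻ a, (∫⁻ b, F a b ^ k ∂ν) ^ k⁻¹ ∂μ := by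
  rcases hk.eq_or_lt with rfl | hk
  · simpa only [ENNReal.rpow_one, inv_one] using (lintegral_lintegral_swap hF.aemeasurable).ge
  · have hkl := Real.HolderConjugate.conjExponent hk
    exact lintegral_rpow_rpow_inv_le_of_forall_lintegral_mul_le hkl hF.lintegral_prod_left
      fun w hw => lintegral_mul_lintegral_le hkl hF hw

end Minkowski

section LpMaps

variable {α : Type*} [MeasurableSpace α] {μ : Measure α} {p q : ℝ≥0∞} [Fact (1 ≤ p)]
  [Fact (1 ≤ q)]

/-- The continuous linear functional `f ↦ ∫_B f dμ` on `L^p(μ)`, for a set `B` of finite measure,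
realised as the pairing with the indicator function of `B`. -/
def setIntegralCLM (p : ℝ≥0∞) [Fact (1 ≤ p)] {B : Set α} (hB : MeasurableSet B)
    (hμB : μ B ≠ ∞) : Lp ℝ p μ →L[ℝ] ℝ :=
  have : Fact (1 ≤ p.conjExponent) := ⟨ENNReal.HolderConjugate.one_le p.conjExponent p⟩
  ContinuousLinearMap.lpPairing μ p.conjExponent p (ContinuousLinearMap.mul ℝ ℝ)
    (indicatorConstLp p.conjExponent hB hμB 1)

lemma setIntegralCLM_apply {B : Set α} (hB : MeasurableSet B) (hμB : μ B ≠ ∞) (f : Lp ℝ p μ) :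
    setIntegralCLM p hB hμB f = ∫ a in B, f a ∂μ := by
  have : Fact (1 ≤ p.conjExponent) := ⟨ENNReal.HolderConjugate.one_le p.conjExponent p⟩
  rw [setIntegralCLM, ContinuousLinearMap.lpPairing_eq_integral, ← integral_indicator hB]
  refine integral_congr_ae ?_
  filter_upwards [indicatorConstLp_coeFn (p := p.conjExponent) (hs := hB) (hμs := hμB)
    (c := (1 : ℝ))] with a ha
  by_cases haB : a ∈ B <;> simp [ha, haB]

lemma setIntegral_norm_le {B : Set α} (hB : MeasurableSet B) (hμB : μ B ≠ ∞) (f : Lp ℝ p μ) :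
    ∫ a in B, ‖f a‖ ∂μ ≤ ‖setIntegralCLM p hB hμB‖ * ‖f‖ := by
  have habs : ∫ a in B, ‖f a‖ ∂μ = setIntegralCLM p hB hμB |f| := by
    rw [setIntegralCLM_apply]
    refine integral_congr_ae (ae_restrict_of_ae ?_)
    filter_upwards [Lp.coeFn_abs f] with a ha
    rw [ha, Real.norm_eq_abs]
  rw [habs, ← norm_abs_eq_norm f]
  exact (le_abs_self _).trans ((setIntegralCLM p hB hμB).le_opNorm |f|)

/-- The inclusion `L^p ⊆ L^q` for `q ≤ p` over a probability measure. -/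
def lpInclusionCLM [IsProbabilityMeasure μ] (h : q ≤ p) : Lp ℝ p μ →L[ℝ] Lp ℝ q μ :=
  LinearMap.mkContinuous
    { toFun := fun f => ((Lp.memLp f).mono_exponent h).toLp f
      map_add' := fun f g => by
        rw [← MemLp.toLp_add]
        exact MemLp.toLp_congr _ _ (Lp.coeFn_add f g)
      map_smul' := fun c f => by
        rw [RingHom.id_apply, ← MemLp.toLp_const_smul]
        exact MemLp.toLp_congr _ _ (Lp.coeFn_smul c f) }
    1 fun f => by
      rw [one_mul, Lp.norm_def f]
      exact (Lp.norm_toLp _ ((Lp.memLp f).mono_exponent h)).trans_le <|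
        ENNReal.toReal_mono (Lp.eLpNorm_ne_top f)
          (eLpNorm_le_eLpNorm_of_exponent_le h (Lp.memLp f).1)

lemma coeFn_lpInclusionCLM [IsProbabilityMeasure μ] (h : q ≤ p) (f : Lp ℝ p μ) :
    lpInclusionCLM h f =ᵐ[μ] f :=
  MemLp.coeFn_toLp ((Lp.memLp f).mono_exponent h)

end LpMaps

section Fubini

variable {α β : Type*} [MeasurableSpace α] [MeasurableSpace β] {μ : Measure α} {ν : Measure β}
  [SFinite ν] {p : ℝ≥0∞} [Fact (1 ≤ p)] {η : β → Lp ℝ p μ} {Y : α → β → ℝ}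

lemma integrable_uncurry_restrict_prod [SFinite μ] (hη : Integrable η ν)
    (hY : Measurable (Function.uncurry Y)) (hηY : ∀ᵐ b ∂ν, η b =ᵐ[μ] fun a => Y a b)
    {B : Set α} (hB : MeasurableSet B) (hμB : μ B ≠ ∞) :
    Integrable (Function.uncurry Y) ((μ.restrict B).prod ν) := by
  refine (integrable_prod_iff' hY.aestronglyMeasurable).2 ⟨?_, ?_⟩
  · filter_upwards [hηY] with b hb
    exact (integrableOn_Lp_of_measure_ne_top (η b) Fact.out hμB).congr (ae_restrict_of_ae hb)
  · refine (hη.norm.const_mul ‖setIntegralCLM p hB hμB‖).mono'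
      hY.stronglyMeasurable.norm.integral_prod_left'.aestronglyMeasurable ?_
    filter_upwards [hηY] with b hb
    rw [Real.norm_of_nonneg (integral_nonneg fun _ => norm_nonneg _)]
    refine le_of_eq_of_le (integral_congr_ae (ae_restrict_of_ae ?_))
      (setIntegral_norm_le hB hμB (η b))
    filter_upwards [hb] with a ha
    rw [Function.uncurry_apply_pair, ha]

theorem coeFn_integral_ae_eq [SigmaFinite μ] (hη : Integrable η ν)
    (hY : Measurable (Function.uncurry Y)) (hηY : ∀ᵐ b ∂ν, η b =ᵐ[μ] fun a => Y a b) :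
    ⇑(∫ b, η b ∂ν) =ᵐ[μ] fun a => ∫ b, Y a b ∂ν := by
  refine ae_eq_of_forall_setIntegral_eq_of_sigmaFinite
    (fun B _ hμB => integrableOn_Lp_of_measure_ne_top _ Fact.out hμB.ne)
    (fun B hB hμB =>
      (integrable_uncurry_restrict_prod hη hY hηY hB hμB.ne).integral_prod_left) ?_
  intro B hB hμB
  rw [← setIntegralCLM_apply hB hμB.ne, ← ContinuousLinearMap.integral_comp_comm _ hη,
    integral_integral_swap (integrable_uncurry_restrict_prod hη hY hηY hB hμB.ne)]
  refine integral_congr_ae ?_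
  filter_upwards [hηY] with b hb
  rw [setIntegralCLM_apply]
  exact integral_congr_ae (ae_restrict_of_ae hb)

end Fubini

section ClosedSubmodule

variable {α E : Type*} [MeasurableSpace α] {μ : Measure α} [SigmaFinite μ]
  [NormedAddCommGroup E] [NormedSpace ℝ E] [CompleteSpace E]

-- The image of `g` in the quotient `E ⧸ K` has vanishing integrals.
lemma ae_mem_of_forall_setIntegral_mem {K : Submodule ℝ E} [IsClosed (K : Set E)] {g : α → E}
    (hg : ∀ B, MeasurableSet B → μ B < ∞ → IntegrableOn g B μ)
    (hgK : ∀ B, MeasurableSet B → μ B < ∞ → ∫ a in B, g a ∂μ ∈ K) :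
    ∀ᵐ a ∂μ, g a ∈ K := by
  have hzero : (fun a => K.mkQL (g a)) =ᵐ[μ] 0 := by
    refine ae_eq_zero_of_forall_setIntegral_eq_of_sigmaFinite
      (fun B hB hμB => K.mkQL.integrable_comp (hg B hB hμB)) fun B hB hμB => ?_
    rw [K.mkQL.integral_comp_comm (hg B hB hμB)]
    exact (Submodule.Quotient.mk_eq_zero K).2 (hgK B hB hμB)
  filter_upwards [hzero] with a ha
  exact (Submodule.Quotient.mk_eq_zero K).1 ha

end ClosedSubmodule

section Swap

variable {S Ω Ω₀ : Type*} [MeasurableSpace S] {μ : Measure S} [MeasurableSpace Ω] {P : Measure Ω}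
  [MeasurableSpace Ω₀] {P₀ : Measure Ω₀} {p q q₀ : ℝ≥0∞} [Fact (1 ≤ q)] [Fact (1 ≤ q₀)]
  {η : Ω → Lp ℝ p μ} {g : S → Lp ℝ q P} {η₀ : Ω₀ → Lp ℝ p μ} {g₀ : S → Lp ℝ q₀ P₀}

lemma isSwap_const [IsFiniteMeasure P] (f : Lp ℝ p μ) :
    IsSwap P q (fun _ => f) fun s => Lp.const q P (f s) :=
  ⟨(Lp.memLp f).continuousLinearMap_comp (Lp.constL q P ℝ), fun z => f z.1,
    ⟨(Lp.stronglyMeasurable f).measurable.comp measurable_fst, .of_forall fun _ => .rfl⟩,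
    .of_forall fun s => Lp.coeFn_const q P (f s)⟩

lemma IsSwap.sub {η' : Ω → Lp ℝ p μ} {g' : S → Lp ℝ q P} (h : IsSwap P q η g)
    (h' : IsSwap P q η' g') : IsSwap P q (fun ω => η ω - η' ω) (fun s => g s - g' s) := by
  obtain ⟨hg, Y, ⟨hY, hηY⟩, hgY⟩ := h
  obtain ⟨hg', Y', ⟨hY', hηY'⟩, hgY'⟩ := h'
  refine ⟨hg.sub hg', Y - Y', ⟨hY.sub hY', ?_⟩, ?_⟩
  · filter_upwards [hηY, hηY'] with ω hω hω'
    exact (Lp.coeFn_sub _ _).trans (hω.sub hω')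
  · filter_upwards [hgY, hgY'] with s hs hs'
    exact (Lp.coeFn_sub _ _).trans (hs.sub hs')

lemma IsSwap.finsetSum {ι : Type*} {η : ι → Ω → Lp ℝ p μ} {g : ι → S → Lp ℝ q P}
    (h : ∀ j, IsSwap P q (η j) (g j)) (F : Finset ι) :
    IsSwap P q (fun ω => ∑ j ∈ F, η j ω) (fun s => ∑ j ∈ F, g j s) := by
  choose hg Y hY hgY using h
  refine ⟨memLp_finsetSum _ fun j _ => hg j, fun z => ∑ j ∈ F, Y j z,
    ⟨Finset.measurable_fun_sum _ fun j _ => (hY j).1, ?_⟩, ?_⟩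
  · filter_upwards [(Finset.eventually_all F).2 fun j _ => (hY j).2] with ω hω
    filter_upwards [Lp.coeFn_finsetSum F fun j => η j ω, (Finset.eventually_all F).2 hω]
      with s hsum hs
    rw [hsum, Finset.sum_apply]
    exact Finset.sum_congr rfl hs
  · filter_upwards [(Finset.eventually_all F).2 fun j _ => hgY j] with s hs
    filter_upwards [Lp.coeFn_finsetSum F fun j => g j s, (Finset.eventually_all F).2 hs]
      with ω hsum hω
    rw [hsum, Finset.sum_apply]
    exact Finset.sum_congr rfl hω

lemma MemSwap.exists_isSwap_of_le [IsProbabilityMeasure P] {q' : ℝ≥0∞} (h : MemSwap P q' η)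
    (hq : q ≤ q') : ∃ g : S → Lp ℝ q P, IsSwap P q η g := by
  obtain ⟨_, g, hg, Y, hY, hgY⟩ := h
  refine ⟨fun s => lpInclusionCLM hq (g s), hg.continuousLinearMap_comp _, Y, hY, ?_⟩
  filter_upwards [hgY] with s hs
  exact (coeFn_lpInclusionCLM hq (g s)).trans hs

lemma IsSwap.coeFn_setIntegral_ae_eq [Fact (1 ≤ p)] [SigmaFinite P] [SFinite μ]
    (h : IsSwap P q η g) {B : Set S} (hB : MeasurableSet B) (hμB : μ B ≠ ∞) :
    ⇑(∫ s in B, g s ∂μ) =ᵐ[P] setIntegralCLM p hB hμB ∘ η := by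
  obtain ⟨hg, Y, ⟨hY, hηY⟩, hgY⟩ := h
  have : IsFiniteMeasure (μ.restrict B) := ⟨by simpa using hμB.lt_top⟩
  have hswap := coeFn_integral_ae_eq (Y := fun ω s => Y (s, ω))
    ((hg.restrict B).integrable Fact.out) (hY.comp measurable_swap) (ae_restrict_of_ae hgY)
  filter_upwards [hswap, hηY] with ω hω hηω
  rw [hω, Function.comp_apply, setIntegralCLM_apply]
  exact (integral_congr_ae (ae_restrict_of_ae hηω)).symm

/-- The pairs `(Φ ∘ η, Φ ∘ η₀)` in `L^q(P) × L^{q₀}(P₀)`, where `Φ` runs through the continuous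
linear functionals on `L^p(μ)`. -/
def functionalPairs (P : Measure Ω) (P₀ : Measure Ω₀) (q q₀ : ℝ≥0∞) [Fact (1 ≤ p)]
    (η : Ω → Lp ℝ p μ) (η₀ : Ω₀ → Lp ℝ p μ) : Submodule ℝ (Lp ℝ q P × Lp ℝ q₀ P₀) where
  carrier := {z | ∃ Φ : Lp ℝ p μ →L[ℝ] ℝ, z.1 =ᵐ[P] Φ ∘ η ∧ z.2 =ᵐ[P₀] Φ ∘ η₀}
  add_mem' := by
    rintro z z' ⟨Φ, hΦ, hΦ₀⟩ ⟨Φ', hΦ', hΦ'₀⟩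
    exact ⟨Φ + Φ', (Lp.coeFn_add _ _).trans (hΦ.add hΦ'), (Lp.coeFn_add _ _).trans (hΦ₀.add hΦ'₀)⟩
  zero_mem' := ⟨0, Lp.coeFn_zero _ _ _, Lp.coeFn_zero _ _ _⟩
  smul_mem' := by
    rintro c z ⟨Φ, hΦ, hΦ₀⟩
    exact ⟨c • Φ, (Lp.coeFn_smul _ _).trans (hΦ.const_smul c),
      (Lp.coeFn_smul _ _).trans (hΦ₀.const_smul c)⟩

variable [Fact (1 ≤ p)] {C : ℝ≥0∞}

lemma enorm_fst_le_of_mem_closure_functionalPairs (hC : C ≠ ∞)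
    (hle : ∀ Φ : Lp ℝ p μ →L[ℝ] ℝ, eLpNorm (Φ ∘ η) q P ≤ C * eLpNorm (Φ ∘ η₀) q₀ P₀)
    {z : Lp ℝ q P × Lp ℝ q₀ P₀} (hz : z ∈ (functionalPairs P P₀ q q₀ η η₀).topologicalClosure) :
    ‖z.1‖ₑ ≤ C * ‖z.2‖ₑ := by
  refine closure_minimal (t := {z | ‖z.1‖ₑ ≤ C * ‖z.2‖ₑ}) ?_ (isClosed_le (by fun_prop)
    ((ENNReal.continuous_const_mul hC).comp (by fun_prop))) hz
  rintro ⟨V, V₀⟩ ⟨Φ, hV, hV₀⟩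
  simpa only [Set.mem_ofPred_eq, Lp.enorm_def, eLpNorm_congr_ae hV, eLpNorm_congr_ae hV₀]
    using hle Φ

variable [SigmaFinite μ] [SigmaFinite P] [SigmaFinite P₀]

-- The integral of `(g, g₀)` over `B` is the pair belonging to the functional `∫_B`.
lemma IsSwap.ae_mem_closure_functionalPairs (h : IsSwap P q η g) (h₀ : IsSwap P₀ q₀ η₀ g₀) :
    ∀ᵐ s ∂μ, (g s, g₀ s) ∈ (functionalPairs P P₀ q q₀ η η₀).topologicalClosure := by
  have hg {B : Set S} (hμB : μ B < ∞) : IntegrableOn g B μ :=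
    have : IsFiniteMeasure (μ.restrict B) := ⟨by simpa using hμB⟩
    (h.1.restrict B).integrable Fact.out
  have hg₀ {B : Set S} (hμB : μ B < ∞) : IntegrableOn g₀ B μ :=
    have : IsFiniteMeasure (μ.restrict B) := ⟨by simpa using hμB⟩
    (h₀.1.restrict B).integrable Fact.out
  have : IsClosed ((functionalPairs P P₀ q q₀ η η₀).topologicalClosure :
      Set (Lp ℝ q P × Lp ℝ q₀ P₀)) := Submodule.isClosed_topologicalClosure _
  refine ae_mem_of_forall_setIntegral_mem (fun B _ hμB => (hg hμB).prodMk (hg₀ hμB)) ?_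
  intro B hB hμB
  refine Submodule.le_topologicalClosure _ ⟨setIntegralCLM p hB hμB.ne, ?_⟩
  rw [integral_pair (hg hμB) (hg₀ hμB)]
  exact ⟨h.coeFn_setIntegral_ae_eq hB hμB.ne, h₀.coeFn_setIntegral_ae_eq hB hμB.ne⟩

lemma IsSwap.eLpNorm_le_of_forall_functional (h : IsSwap P q η g) (h₀ : IsSwap P₀ q₀ η₀ g₀)
    (hC : C ≠ ∞)
    (hle : ∀ Φ : Lp ℝ p μ →L[ℝ] ℝ, eLpNorm (Φ ∘ η) q P ≤ C * eLpNorm (Φ ∘ η₀) q₀ P₀) :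
    eLpNorm g p μ ≤ C * eLpNorm g₀ p μ := by
  refine eLpNorm_le_mul_eLpNorm_of_ae_le_mul'' p h₀.1.1 ?_
  filter_upwards [h.ae_mem_closure_functionalPairs h₀] with s hs
  exact enorm_fst_le_of_mem_closure_functionalPairs (z := (g s, g₀ s)) hC hle hs

end Swap

section SwapNorm

variable {S Ω Ω₀ : Type*} [MeasurableSpace S] {μ : Measure S} [SigmaFinite μ] [MeasurableSpace Ω]
  {P : Measure Ω} [SigmaFinite P] [MeasurableSpace Ω₀] {P₀ : Measure Ω₀} [SigmaFinite P₀]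
  {p q q₀ C : ℝ≥0∞} [Fact (1 ≤ p)] {η : Ω → Lp ℝ p μ} {η₀ : Ω₀ → Lp ℝ p μ}

theorem swapNorm_le_of_forall_functional (hη : MemSwap P q η) (hC0 : C ≠ 0) (hC : C ≠ ∞)
    (hle : ∀ Φ : Lp ℝ p μ →L[ℝ] ℝ, eLpNorm (Φ ∘ η) q P ≤ C * eLpNorm (Φ ∘ η₀) q₀ P₀) :
    swapNorm P q η ≤ C * swapNorm P₀ q₀ η₀ := by
  obtain ⟨hq, g, hg⟩ := hη
  have hinf : C * swapNorm P₀ q₀ η₀ =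
      ⨅ (_ : Fact (1 ≤ q₀)) (g₀ : S → Lp ℝ q₀ P₀) (_ : IsSwap P₀ q₀ η₀ g₀),
        C * eLpNorm g₀ p μ := by
    simp only [swapNorm, ENNReal.mul_iInf_of_ne hC0 hC]
  rw [hinf]
  refine le_iInf fun hq₀ => le_iInf fun g₀ => le_iInf fun hg₀ => ?_
  exact (iInf_le_of_le hq <| iInf_le_of_le g <| iInf_le _ hg).trans
    (hg.eLpNorm_le_of_forall_functional hg₀ hC hle)

theorem eLpNorm_le_swapNorm (hpq : p ≤ q) (hq : q ≠ ∞) :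
    eLpNorm η q P ≤ swapNorm P q η := by
  refine le_iInf fun hq1 => le_iInf fun g => le_iInf fun ⟨_, Y, ⟨hY, hηY⟩, hgY⟩ => ?_
  have hp0 : p ≠ 0 := (zero_lt_one.trans_le Fact.out).ne'
  have hpt : p ≠ ∞ := ne_top_of_le_ne_top hq hpq
  have hq0 : q ≠ 0 := (zero_lt_one.trans_le hq1.out).ne'
  have hpr : 0 < p.toReal := ENNReal.toReal_pos hp0 hpt
  have hqr : 0 < q.toReal := ENNReal.toReal_pos hq0 hq
  set k := q.toReal / p.toReal with hk
  have hk1 : 1 ≤ k := (one_le_div hpr).2 (ENNReal.toReal_mono hq hpq)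
  have hη : ∀ᵐ ω ∂P, ‖η ω‖ₑ ^ q.toReal = (∫⁻ s, ‖Y (s, ω)‖ₑ ^ p.toReal ∂μ) ^ k := by
    filter_upwards [hηY] with ω hω
    rw [Lp.enorm_def, eLpNorm_congr_ae hω, eLpNorm_eq_lintegral_rpow_enorm_toReal hp0 hpt,
      ← ENNReal.rpow_mul, one_div_mul_eq_div]
  have hg : ∀ᵐ s ∂μ, ‖g s‖ₑ ^ p.toReal =
      (∫⁻ ω, (‖Y (s, ω)‖ₑ ^ p.toReal) ^ k ∂P) ^ k⁻¹ := by
    filter_upwards [hgY] with s hs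
    rw [Lp.enorm_def, eLpNorm_congr_ae hs, eLpNorm_eq_lintegral_rpow_enorm_toReal hq0 hq,
      ← ENNReal.rpow_mul, one_div_mul_eq_div]
    simp only [← ENNReal.rpow_mul, hk, mul_div_cancel₀ _ hpr.ne', inv_div]
  rw [eLpNorm_eq_lintegral_rpow_enorm_toReal hq0 hq, eLpNorm_eq_lintegral_rpow_enorm_toReal hp0 hpt,
    lintegral_congr_ae hη, lintegral_congr_ae hg,
    show 1 / q.toReal = k⁻¹ * (1 / p.toReal) by rw [hk]; field_simp, ENNReal.rpow_mul]
  exact ENNReal.rpow_le_rpow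
    (lintegral_lintegral_rpow_rpow_inv_le hk1 (hY.enorm.pow_const _)) (by positivity)

end SwapNorm

section SampleMean

variable {S Ω Ω' : Type*} [MeasurableSpace S] {μ : Measure S} [MeasurableSpace Ω] {P : Measure Ω}
  [IsProbabilityMeasure P] [MeasurableSpace Ω'] {P' : Measure Ω'} [IsProbabilityMeasure P']

lemma eLpNorm_comp_sum_sub_integral_le {E : Type*} [NormedAddCommGroup E] [NormedSpace ℝ E]
    [CompleteSpace E] [MeasurableSpace E] [BorelSpace E] {t : ℝ} (ht1 : 1 ≤ t) (ht2 : t ≤ 2)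
    {U : ℕ → Ω → E} {V : Ω' → E} (hindep : iIndepFun U P)
    (hident : ∀ j, IdentDistrib (U j) V P P') (hV : Integrable V P') {m : ℕ} (hm : m ≠ 0)
    (Φ : E →L[ℝ] ℝ) :
    eLpNorm (Φ ∘ fun ω => ∑ j ∈ Finset.range m, (U j ω - ∫ ω', V ω' ∂P')) (ENNReal.ofReal t) P ≤
      ENNReal.ofReal ((2 * m) ^ t⁻¹) *
        eLpNorm (Φ ∘ fun ω => V ω - ∫ ω', V ω' ∂P') (ENNReal.ofReal t) P' := by
  have hφ : Measurable fun f => Φ (f - ∫ ω', V ω' ∂P') := by fun_prop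
  have hVc : Integrable (fun ω => V ω - ∫ ω', V ω' ∂P') P' := hV.sub (integrable_const _)
  have hmean : ∫ ω, Φ (V ω - ∫ ω', V ω' ∂P') ∂P' = 0 := by
    rw [Φ.integral_comp_comm hVc, integral_sub hV (integrable_const _), integral_const,
      probReal_univ, one_smul, sub_self, map_zero]
  have hsum : (Φ ∘ fun ω => ∑ j ∈ Finset.range m, (U j ω - ∫ ω', V ω' ∂P')) =
      ∑ j ∈ Finset.range m, fun ω => Φ (U j ω - ∫ ω', V ω' ∂P') := by
    ext ω
    rw [Function.comp_apply, map_sum, Finset.sum_apply]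
  rw [hsum]
  exact eLpNorm_sum_le_of_identDistrib ht1 ht2 (hindep.comp _ fun _ => hφ)
    (fun j => (hident j).comp hφ) hmean hm

variable {p : ℝ≥0∞} [Fact (1 ≤ p)] [MeasurableSpace (Lp ℝ p μ)] [BorelSpace (Lp ℝ p μ)]
  [SigmaFinite μ] {t : ℝ} {U : ℕ → Ω → Lp ℝ p μ} {V : Ω' → Lp ℝ p μ} {m : ℕ}

theorem swapNorm_sum_sub_integral_le (ht1 : 1 ≤ t) (ht2 : t ≤ 2) (hindep : iIndepFun U P)
    (hident : ∀ j, IdentDistrib (U j) V P P') (hV : Integrable V P')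
    (hU : ∀ j, MemSwap P (ENNReal.ofReal t) (U j)) (hm : m ≠ 0) :
    swapNorm P (ENNReal.ofReal t)
        (fun ω => ∑ j ∈ Finset.range m, (U j ω - ∫ ω', V ω' ∂P')) ≤
      ENNReal.ofReal ((2 * m) ^ t⁻¹) *
        swapNorm P' (ENNReal.ofReal t) fun ω => V ω - ∫ ω', V ω' ∂P' := by
  have : Fact (1 ≤ ENNReal.ofReal t) := ⟨ENNReal.one_le_ofReal.2 ht1⟩
  choose _ g hg using hU
  refine swapNorm_le_of_forall_functional
    ⟨this, _, IsSwap.finsetSum (fun j => (hg j).sub (isSwap_const _)) (Finset.range m)⟩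
    (ENNReal.ofReal_ne_zero_iff.2 (by positivity)) ENNReal.ofReal_ne_top
    (eLpNorm_comp_sum_sub_integral_le ht1 ht2 hindep hident hV hm)

theorem eLpNorm_sampleMean_sub_integral_le (ht1 : 1 ≤ t) (ht2 : t ≤ 2)
    (hpt : p ≤ ENNReal.ofReal t) (hindep : iIndepFun U P)
    (hident : ∀ j, IdentDistrib (U j) V P P') (hV : Integrable V P')
    (hU : ∀ j, MemSwap P (ENNReal.ofReal t) (U j)) (hm : m ≠ 0) :
    eLpNorm (fun ω => (1 / (m : ℝ)) • ∑ j ∈ Finset.range m, U j ω - ∫ ω', V ω' ∂P')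
        (ENNReal.ofReal t) P ≤
      ENNReal.ofReal (2 ^ t⁻¹ * m ^ (t⁻¹ - 1)) *
        swapNorm P' (ENNReal.ofReal t) fun ω => V ω - ∫ ω', V ω' ∂P' := by
  have hm0 : (0 : ℝ) < m := by positivity
  have hmean : (fun ω => (1 / (m : ℝ)) • ∑ j ∈ Finset.range m, U j ω - ∫ ω', V ω' ∂P') =
      (1 / (m : ℝ)) • fun ω => ∑ j ∈ Finset.range m, (U j ω - ∫ ω', V ω' ∂P') := by
    ext1 ω
    rw [Pi.smul_apply, Finset.sum_sub_distrib, Finset.sum_const, Finset.card_range, smul_sub,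
      ← Nat.cast_smul_eq_nsmul ℝ, smul_smul, one_div_mul_cancel hm0.ne', one_smul]
  have hconst : 2 ^ t⁻¹ * (m : ℝ) ^ (t⁻¹ - 1) = 1 / m * (2 * m) ^ t⁻¹ := by
    rw [Real.rpow_sub_one hm0.ne', Real.mul_rpow zero_le_two hm0.le]
    ring
  rw [hmean, eLpNorm_const_smul, hconst, ENNReal.ofReal_mul (by positivity), mul_assoc,
    Real.enorm_of_nonneg (by positivity)]
  gcongr
  exact (eLpNorm_le_swapNorm hpt ENNReal.ofReal_ne_top).trans
    (swapNorm_sum_sub_integral_le ht1 ht2 hindep hident hV hU hm)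

theorem eLpNorm_sampleMean_sub_integral_sub_le {V W : Ω' → Lp ℝ p μ} {d : ℝ} (ht1 : 1 ≤ t)
    (ht2 : t ≤ 2) (hpt : p ≤ ENNReal.ofReal t) (hindep : iIndepFun U P)
    (hident : ∀ j, IdentDistrib (U j) (fun ω => V ω - W ω) P P') (hV : Integrable V P')
    (hW : Integrable W P') (hU : ∀ j, MemSwap P (ENNReal.ofReal t) (U j)) (hm : m ≠ 0)
    (hd : swapNorm P' (ENNReal.ofReal t)
      (fun ω => V ω - ∫ ω', V ω' ∂P' - (W ω - ∫ ω', W ω' ∂P')) ≤ ENNReal.ofReal d) :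
    eLpNorm (fun ω => (1 / (m : ℝ)) • ∑ j ∈ Finset.range m, U j ω -
        (∫ ω', V ω' ∂P' - ∫ ω', W ω' ∂P')) (ENNReal.ofReal t) P ≤
      ENNReal.ofReal (2 ^ t⁻¹ * d * m ^ (t⁻¹ - 1)) := by
  have hmean := eLpNorm_sampleMean_sub_integral_le ht1 ht2 hpt hindep hident (hV.sub hW) hU hm
  have hcentered (ω : Ω') :=
    sub_sub_sub_comm (V ω) (∫ ω', V ω' ∂P') (W ω) (∫ ω', W ω' ∂P')
  simp only [hcentered] at hd
  rw [integral_sub hV hW] at hmean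
  rw [mul_right_comm, ENNReal.ofReal_mul (by positivity)]
  exact hmean.trans (mul_le_mul_right hd _)

end SampleMean

section Allocation

variable {s ε : ℝ}

lemma natCeil_rpow_rpow_neg_inv_le (hs : 0 < s) {y : ℝ} (hy : 0 < y) :
    (⌈y ^ s⌉₊ : ℝ) ^ (-s⁻¹) ≤ y⁻¹ := by
  calc (⌈y ^ s⌉₊ : ℝ) ^ (-s⁻¹)
    _ ≤ (y ^ s) ^ (-s⁻¹) :=
        Real.rpow_le_rpow_of_nonpos (by positivity) (Nat.le_ceil _) (by simp [hs.le])
    _ = y⁻¹ := by rw [Real.rpow_neg (by positivity), Real.rpow_rpow_inv hy.le hs.ne']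

lemma mul_div_rpow_eq_of_rpow_add_one_eq {a c w W : ℝ} (ha : 0 < a) (hw : 0 < w) (hW : 0 < W)
    (hε : 0 < ε) (hwpow : w ^ (s + 1) = a ^ s * c) :
    c * (a * W / (ε * w)) ^ s = ε ^ (-s) * W ^ s * w := by
  have hws : a ^ s * c = w ^ s * w := by rw [← hwpow, Real.rpow_add_one hw.ne']
  calc c * (a * W / (ε * w)) ^ s
    _ = a ^ s * c * (W ^ s / (ε ^ s * w ^ s)) := by
        rw [Real.div_rpow (by positivity) (by positivity), Real.mul_rpow ha.le hW.le,
          Real.mul_rpow hε.le hw.le]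
        ring
    _ = ε ^ (-s) * W ^ s * w := by
        rw [hws, Real.rpow_neg hε.le]
        have := (Real.rpow_pos_of_pos hw s).ne'
        field_simp

variable {ι : Type*} {a c : ι → ℝ}

-- Up to rounding, this choice of `M` is the Lagrange minimiser of the cost for a given error.
theorem exists_sampleSizes (I : Finset ι) (ha : ∀ l, 0 < a l) (hc : ∀ l, 0 < c l) (hs : 0 < s)
    (hε : 0 < ε) :
    ∃ M : ι → ℕ, (∀ l ∈ I, 1 ≤ M l) ∧ ∑ l ∈ I, a l * (M l : ℝ) ^ (-s⁻¹) ≤ ε ∧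
      ∑ l ∈ I, c l * (M l : ℝ) ≤
        ∑ l ∈ I, c l + ε ^ (-s) * (∑ l ∈ I, (a l ^ s * c l) ^ (s + 1)⁻¹) ^ (s + 1) := by
  set w : ι → ℝ := fun l => (a l ^ s * c l) ^ (s + 1)⁻¹
  set W := ∑ l ∈ I, w l with hW
  have hac (l : ι) : 0 < a l ^ s * c l := mul_pos (Real.rpow_pos_of_pos (ha l) s) (hc l)
  have hw0 (l : ι) : 0 < w l := Real.rpow_pos_of_pos (hac l) _
  have hW0 {l : ι} (hl : l ∈ I) : 0 < W := Finset.sum_pos (fun l _ => hw0 l) ⟨l, hl⟩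
  have hy0 {l : ι} (hl : l ∈ I) : 0 < a l * W / (ε * w l) :=
    div_pos (mul_pos (ha l) (hW0 hl)) (mul_pos hε (hw0 l))
  refine ⟨fun l => ⌈(a l * W / (ε * w l)) ^ s⌉₊,
    fun l hl => Nat.one_le_ceil_iff.2 (Real.rpow_pos_of_pos (hy0 hl) s), ?_, ?_⟩
  · have herror {l : ι} (hl : l ∈ I) :
        a l * (⌈(a l * W / (ε * w l)) ^ s⌉₊ : ℝ) ^ (-s⁻¹) ≤ ε / W * w l := by
      refine (mul_le_mul_of_nonneg_left (natCeil_rpow_rpow_neg_inv_le hs (hy0 hl))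
        (ha l).le).trans_eq ?_
      have := (ha l).ne'
      field_simp
    calc _ ≤ ∑ l ∈ I, ε / W * w l := Finset.sum_le_sum fun l hl => herror hl
      _ = ε * (W / W) := by rw [← Finset.mul_sum, ← hW]; ring
      _ ≤ ε := mul_le_of_le_one_right hε.le (div_self_le_one W)
  · have hcost {l : ι} (hl : l ∈ I) :
        c l * (⌈(a l * W / (ε * w l)) ^ s⌉₊ : ℝ) ≤ c l + ε ^ (-s) * W ^ s * w l := by
      rw [← mul_div_rpow_eq_of_rpow_add_one_eq (ha l) (hw0 l) (hW0 hl) hε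
        (Real.rpow_inv_rpow (hac l).le (by positivity)), ← mul_one_add]
      refine mul_le_mul_of_nonneg_left ?_ (hc l).le
      exact (Nat.ceil_lt_add_one (Real.rpow_nonneg (hy0 hl).le s)).le.trans_eq (add_comm _ _)
    refine (Finset.sum_le_sum fun l hl => hcost hl).trans_eq ?_
    rw [Finset.sum_add_distrib, ← Finset.mul_sum, ← hW, mul_assoc,
      ← Real.rpow_add_one' (Finset.sum_nonneg fun l _ => (hw0 l).le) (by positivity)]

end Allocation

section GeometricLevels

variable {α γ b A s C D : ℝ}

lemma exists_sum_pow_rpow_le_of_neg (hA : 1 < A) {θ : ℝ} (hθ : θ < 0) :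
    ∃ C, 0 < C ∧ ∀ L : ℕ, ∑ l ∈ Finset.Icc 1 L, (A ^ l) ^ θ ≤ C := by
  have hx0 : 0 < A ^ θ := by positivity
  have hx1 : A ^ θ < 1 := Real.rpow_lt_one_of_one_lt_of_neg hA hθ
  refine ⟨A ^ θ / (1 - A ^ θ), div_pos hx0 (sub_pos.2 hx1), fun L => ?_⟩
  simp only [← Real.rpow_pow_comm (zero_le_one.trans hA.le), ← Finset.Ico_add_one_right_eq_Icc]
  simpa only [pow_one] using geom_sum_Ico_le_of_lt_one (m := 1) (n := L + 1) hx0.le hx1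

lemma exists_sum_pow_rpow_le_of_pos (hA : 1 < A) {θ : ℝ} (hθ : 0 < θ) :
    ∃ C, 0 < C ∧ ∀ L : ℕ, ∑ l ∈ Finset.Icc 1 L, (A ^ l) ^ θ ≤ C * (A ^ L) ^ θ := by
  have hx : 0 < A ^ θ - 1 := sub_pos.2 (Real.one_lt_rpow hA hθ)
  refine ⟨A ^ θ / (A ^ θ - 1), by positivity, fun L => ?_⟩
  simp only [← Real.rpow_pow_comm (zero_le_one.trans hA.le), ← Finset.Ico_add_one_right_eq_Icc]
  rw [geom_sum_Ico (sub_pos.1 hx).ne' (by lia), div_mul_eq_mul_div, pow_succ', pow_one]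
  gcongr
  exact sub_le_self _ (by positivity)

lemma exists_natCast_le_mul_abs_logb (hA : 1 < A) (hα : 0 < α) (hD : 0 < D) :
    ∃ C, 0 < C ∧ ∀ ε ∈ Set.Ioc (0 : ℝ) (1 / 2), ∀ L : ℕ, A ^ L ≤ D * ε ^ (-α⁻¹) →
      L ≤ C * |Real.logb A ε| := by
  have hlog2 : 0 < Real.logb A 2 := Real.logb_pos hA one_lt_two
  refine ⟨|Real.logb A D| / Real.logb A 2 + α⁻¹, by positivity, fun ε ⟨hε0, hε⟩ L hL => ?_⟩
  have hlogε : Real.logb A ε ≤ -Real.logb A 2 := by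
    rw [← Real.logb_inv]
    exact Real.logb_le_logb_of_le hA hε0 (by simpa using hε)
  rw [abs_of_nonpos (hlogε.trans (neg_nonpos.2 hlog2.le))]
  calc (L : ℝ) = Real.logb A (A ^ L) := by
        rw [Real.logb_pow, Real.logb_self_eq_one hA, mul_one]
    _ ≤ Real.logb A (D * ε ^ (-α⁻¹)) := Real.logb_le_logb_of_le hA (by positivity) hL
    _ = Real.logb A D + α⁻¹ * -Real.logb A ε := by
        rw [Real.logb_mul hD.ne' (by positivity), Real.logb_rpow_eq_mul_logb_of_pos hε0]
        ring
    _ ≤ |Real.logb A D| / Real.logb A 2 * -Real.logb A ε + α⁻¹ * -Real.logb A ε := by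
        gcongr
        rw [div_mul_eq_mul_div, le_div_iff₀ hlog2]
        exact mul_le_mul (le_abs_self _) (by linarith) hlog2.le (abs_nonneg _)
    _ = _ := by ring

lemma exists_finest_level (hA : 1 < A) (hα : 0 < α) (hC : 0 < C) :
    ∃ D, 0 < D ∧ ∀ ε ∈ Set.Ioc (0 : ℝ) 1, ∃ L : ℕ, 1 ≤ L ∧ C * (A ^ L) ^ (-α) < ε ∧
      A ^ L ≤ D * ε ^ (-α⁻¹) := by
  have : 0 < A := zero_lt_one.trans hA
  set D := max 1 (C ^ α⁻¹)
  have hD0 : 0 < D := zero_lt_one.trans_le (le_max_left _ _)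
  refine ⟨A * D, by positivity, fun ε ⟨hε0, hε⟩ => ?_⟩
  have hx : 1 ≤ D * ε ^ (-α⁻¹) := one_le_mul_of_one_le_of_one_le (le_max_left _ _)
    (Real.one_le_rpow_of_pos_of_le_one_of_nonpos hε0 hε (by simp [hα.le]))
  obtain ⟨n, hn, hn'⟩ := exists_nat_pow_near hx hA
  refine ⟨n + 1, by lia, ?_, ?_⟩
  · have hCD : C ≤ D ^ α :=
      (Real.rpow_inv_le_iff_of_pos hC.le hD0.le hα).1 (le_max_right _ _)
    calc C * (A ^ (n + 1)) ^ (-α)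
      _ < C * (D * ε ^ (-α⁻¹)) ^ (-α) := by
          gcongr 1
          exact Real.rpow_lt_rpow_of_neg (by positivity) hn' (neg_neg_of_pos hα)
      _ = C / D ^ α * ε := by
          rw [Real.mul_rpow hD0.le (by positivity), ← Real.rpow_mul hε0.le, neg_mul_neg,
            inv_mul_cancel₀ hα.ne', Real.rpow_one, Real.rpow_neg hD0.le]
          ring
      _ ≤ ε := mul_le_of_le_one_left hε0.le ((div_le_one (by positivity)).2 hCD)
  · rw [pow_succ', mul_assoc]
    gcongr

lemma exists_sum_pow_rpow_le_rpow_neg_div (hA : 1 < A) (hD : 0 < D) {θ : ℝ} (hθ : 0 < θ) :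
    ∃ C, 0 < C ∧ ∀ ε, 0 < ε → ∀ L : ℕ, A ^ L ≤ D * ε ^ (-α⁻¹) →
      ∑ l ∈ Finset.Icc 1 L, (A ^ l) ^ θ ≤ C * ε ^ (-(θ / α)) := by
  obtain ⟨C, hC, hsum⟩ := exists_sum_pow_rpow_le_of_pos hA hθ
  refine ⟨C * D ^ θ, by positivity, fun ε hε L hL => ?_⟩
  calc ∑ l ∈ Finset.Icc 1 L, (A ^ l) ^ θ
    _ ≤ C * (A ^ L) ^ θ := hsum L
    _ ≤ C * (D * ε ^ (-α⁻¹)) ^ θ := by gcongr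
    _ = C * D ^ θ * ε ^ (-(θ / α)) := by
        rw [Real.mul_rpow hD.le (by positivity), ← Real.rpow_mul hε.le]
        ring_nf

lemma rpow_neg_div_le_costOrder {ε : ℝ} (hε : 0 ≤ ε) :
    ε ^ (-(γ / α)) ≤ costOrder α b γ A s ε := by
  unfold costOrder
  split_ifs <;> exact le_add_of_nonneg_right (by positivity)

lemma rpow_neg_le_costOrder {ε : ℝ} (hε : 0 ≤ ε) (hs : 0 < s) (h : γ < b * s) :
    ε ^ (-s) ≤ costOrder α b γ A s ε := by
  rw [costOrder, if_pos ((div_lt_iff₀ hs).2 h)]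
  exact le_add_of_nonneg_left (by positivity)

lemma rpow_neg_mul_abs_logb_rpow_le_costOrder {ε : ℝ} (hε : 0 ≤ ε) (hs : 0 < s)
    (h : γ = b * s) :
    ε ^ (-s) * |Real.logb A ε| ^ (s + 1) ≤ costOrder α b γ A s ε := by
  have hb : b = γ / s := eq_div_of_mul_eq hs.ne' h.symm
  rw [costOrder, if_neg hb.not_gt, if_pos hb]
  exact le_add_of_nonneg_left (by positivity)

lemma rpow_neg_sub_div_le_costOrder {ε : ℝ} (hε : 0 ≤ ε) (hs : 0 < s) (h : b * s < γ) :
    ε ^ (-s - (γ - b * s) / α) ≤ costOrder α b γ A s ε := by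
  have hb : b < γ / s := (lt_div_iff₀ hs).2 h
  rw [costOrder, if_neg hb.not_gt, if_neg hb.ne]
  exact le_add_of_nonneg_left (by positivity)

theorem exists_rpow_neg_mul_sum_rpow_le_costOrder (hA : 1 < A) (hα : 0 < α) (hs : 0 < s)
    (hD : 0 < D) :
    ∃ K, 0 < K ∧ ∀ ε ∈ Set.Ioc (0 : ℝ) (1 / 2), ∀ L : ℕ, A ^ L ≤ D * ε ^ (-α⁻¹) →
      ε ^ (-s) * (∑ l ∈ Finset.Icc 1 L, (A ^ l) ^ ((γ - b * s) / (s + 1))) ^ (s + 1) ≤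
        K * costOrder α b γ A s ε := by
  have hs1 : 0 < s + 1 := by linarith
  set θ := (γ - b * s) / (s + 1) with hθ
  rcases lt_trichotomy γ (b * s) with h | h | h
  · obtain ⟨C, hC, hsum⟩ :=
      exists_sum_pow_rpow_le_of_neg hA (θ := θ) (div_neg_of_neg_of_pos (by linarith) hs1)
    refine ⟨C ^ (s + 1), by positivity, fun ε ⟨hε, _⟩ L _ => ?_⟩
    rw [mul_comm]
    gcongr
    exacts [hsum L, rpow_neg_le_costOrder hε.le hs h]
  · obtain ⟨C, hC, hlog⟩ := exists_natCast_le_mul_abs_logb hA hα hD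
    refine ⟨C ^ (s + 1), by positivity, fun ε hε L hL => ?_⟩
    have hsum : ∑ l ∈ Finset.Icc 1 L, (A ^ l) ^ θ = L := by simp [hθ, h]
    calc ε ^ (-s) * (∑ l ∈ Finset.Icc 1 L, (A ^ l) ^ θ) ^ (s + 1)
      _ ≤ ε ^ (-s) * (C * |Real.logb A ε|) ^ (s + 1) := by
          have := hε.1
          rw [hsum]
          gcongr
          exact hlog ε hε L hL
      _ = C ^ (s + 1) * (ε ^ (-s) * |Real.logb A ε| ^ (s + 1)) := by
          rw [Real.mul_rpow hC.le (abs_nonneg _), mul_left_comm]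
      _ ≤ _ := by
          gcongr
          exact rpow_neg_mul_abs_logb_rpow_le_costOrder hε.1.le hs h
  · obtain ⟨C, hC, hsum⟩ := exists_sum_pow_rpow_le_rpow_neg_div (α := α) hA hD (θ := θ)
      (div_pos (by linarith) hs1)
    refine ⟨C ^ (s + 1), by positivity, fun ε ⟨hε, _⟩ L hL => ?_⟩
    calc ε ^ (-s) * (∑ l ∈ Finset.Icc 1 L, (A ^ l) ^ θ) ^ (s + 1)
      _ ≤ ε ^ (-s) * (C * ε ^ (-(θ / α))) ^ (s + 1) := by
          gcongr
          exact hsum ε hε L hL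
      _ = C ^ (s + 1) * ε ^ (-s - (γ - b * s) / α) := by
          rw [Real.mul_rpow hC.le (by positivity), ← Real.rpow_mul hε.le, mul_left_comm,
            ← Real.rpow_add hε, hθ]
          congr 2
          field_simp
          ring
      _ ≤ _ := by
          gcongr
          exact rpow_neg_sub_div_le_costOrder hε.le hs h

lemma levelWeight_eq {Cb Cc x : ℝ} (hCb : 0 ≤ Cb) (hCc : 0 ≤ Cc) (hx : 0 < x) :
    ((Cb * x ^ (-b)) ^ s * (Cc * x ^ γ)) ^ (s + 1)⁻¹ =
      (Cb ^ s * Cc) ^ (s + 1)⁻¹ * x ^ ((γ - b * s) / (s + 1)) := by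
  have hprod : (Cb * x ^ (-b)) ^ s * (Cc * x ^ γ) = Cb ^ s * Cc * x ^ (γ - b * s) := by
    rw [Real.mul_rpow hCb (by positivity), ← Real.rpow_mul hx.le, sub_eq_add_neg γ,
      Real.rpow_add hx, neg_mul]
    ring
  rw [hprod, Real.mul_rpow (by positivity) (by positivity), ← Real.rpow_mul hx.le, div_eq_mul_inv]

theorem exists_levels_sampleSizes {Ca Cb Cc : ℝ} (hA : 1 < A) (hα : 0 < α) (hγ : 0 < γ)
    (hs : 0 < s) (hCa : 0 < Ca) (hCb : 0 < Cb) (hCc : 0 < Cc) :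
    ∃ K, 0 < K ∧ ∀ ε ∈ Set.Ioc (0 : ℝ) (1 / 2), ∃ (L : ℕ) (M : ℕ → ℕ), 1 ≤ L ∧
      (∀ l ∈ Finset.Icc 1 L, 1 ≤ M l) ∧ Ca * (A ^ L) ^ (-α) < ε / 2 ∧
      ∑ l ∈ Finset.Icc 1 L, Cb * (A ^ l) ^ (-b) * (M l : ℝ) ^ (-s⁻¹) ≤ ε / 2 ∧
      ∑ l ∈ Finset.Icc 1 L, Cc * (A ^ l) ^ γ * (M l : ℝ) ≤ K * costOrder α b γ A s ε := by
  have hA0 : 0 < A := zero_lt_one.trans hA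
  obtain ⟨D, hD, hlevel⟩ := exists_finest_level hA hα (mul_pos two_pos hCa)
  obtain ⟨B, hB, hone⟩ := exists_sum_pow_rpow_le_rpow_neg_div (α := α) hA hD hγ
  obtain ⟨G, hG, hgeom⟩ :=
    exists_rpow_neg_mul_sum_rpow_le_costOrder (γ := γ) (b := b) hA hα hs hD
  refine ⟨Cc * B + 2 ^ s * (Cb ^ s * Cc) * G, by positivity, fun ε hε => ?_⟩
  have hε0 : 0 < ε := hε.1
  obtain ⟨L, hL1, hbias, hL⟩ := hlevel ε ⟨hε0, hε.2.trans one_half_lt_one.le⟩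
  obtain ⟨M, hM1, herror, hcost⟩ := exists_sampleSizes (Finset.Icc 1 L)
    (a := fun l => Cb * (A ^ l) ^ (-b)) (c := fun l => Cc * (A ^ l) ^ γ)
    (fun l => by positivity) (fun l => by positivity) hs (half_pos hε0)
  refine ⟨L, M, hL1, hM1, by linarith, herror, hcost.trans ?_⟩
  simp only [levelWeight_eq hCb.le hCc.le (pow_pos hA0 _), ← Finset.mul_sum]
  rw [Real.mul_rpow (by positivity) (by positivity), Real.rpow_inv_rpow (by positivity)
    (by positivity), Real.div_rpow hε0.le zero_le_two, Real.rpow_neg zero_le_two, add_mul]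
  have hround : Cc * ∑ l ∈ Finset.Icc 1 L, (A ^ l) ^ γ ≤ Cc * B * costOrder α b γ A s ε := by
    rw [mul_assoc]
    gcongr
    exact (hone ε hε0 L hL).trans (by gcongr; exact rpow_neg_div_le_costOrder hε0.le)
  have hsample := mul_le_mul_of_nonneg_left (hgeom ε hε L hL)
    (show 0 ≤ 2 ^ s * (Cb ^ s * Cc) by positivity)
  refine add_le_add hround (le_trans (le_of_eq ?_) (hsample.trans_eq (mul_assoc _ _ _).symm))
  rw [div_inv_eq_mul]
  ring

end GeometricLevels

section Error

variable {Ω E : Type*} [NormedAddCommGroup E] [NormedSpace ℝ E] {x : E} {y : ℕ → E}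
  {ξ : ℕ → ℕ → Ω → E} {L : ℕ} {M : ℕ → ℕ}

lemma sub_estimator_eq (hy : y 0 = 0) (ω : Ω) :
    x - estimator ξ L M ω = x - y L - ∑ l ∈ Finset.Icc 1 L,
      ((1 / (M l : ℝ)) • ∑ j ∈ Finset.range (M l), ξ l j ω - (y l - y (l - 1))) := by
  have htelescope : ∑ l ∈ Finset.Icc 1 L, (y l - y (l - 1)) = y L := by
    rw [← Finset.Ico_add_one_right_eq_Icc, Finset.sum_Ico_eq_sum_range]
    simpa [add_comm 1, hy] using Finset.sum_range_sub y L
  rw [Finset.sum_sub_distrib, htelescope, estimator]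
  abel

variable [MeasurableSpace Ω] {P : Measure Ω}

lemma aestronglyMeasurable_estimator
    (hξ : ∀ l ∈ Finset.Icc 1 L, ∀ j, AEStronglyMeasurable (ξ l j) P) :
    AEStronglyMeasurable (estimator ξ L M) P :=
  Finset.aestronglyMeasurable_fun_sum _ fun l hl =>
    (Finset.aestronglyMeasurable_fun_sum _ fun j _ => hξ l hl j).const_smul _

variable [IsProbabilityMeasure P] {q : ℝ≥0∞}

theorem eLpNorm_sub_estimator_le (hq : 1 ≤ q) (hy : y 0 = 0)
    (hξ : ∀ l ∈ Finset.Icc 1 L, ∀ j, AEStronglyMeasurable (ξ l j) P) :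
    eLpNorm (fun ω => x - estimator ξ L M ω) q P ≤ ‖x - y L‖ₑ + ∑ l ∈ Finset.Icc 1 L,
      eLpNorm (fun ω => (1 / (M l : ℝ)) • ∑ j ∈ Finset.range (M l), ξ l j ω - (y l - y (l - 1)))
        q P := by
  have hmeas (l : ℕ) (hl : l ∈ Finset.Icc 1 L) : AEStronglyMeasurable (fun ω =>
      (1 / (M l : ℝ)) • ∑ j ∈ Finset.range (M l), ξ l j ω - (y l - y (l - 1))) P :=
    ((Finset.aestronglyMeasurable_fun_sum _ fun j _ => hξ l hl j).const_smul _).sub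
      aestronglyMeasurable_const
  simp only [sub_estimator_eq hy]
  refine (eLpNorm_sub_le aestronglyMeasurable_const
    (Finset.aestronglyMeasurable_fun_sum _ hmeas) hq).trans (add_le_add ?_ ?_)
  · simp [eLpNorm_const _ (zero_lt_one.trans_le hq).ne' (IsProbabilityMeasure.ne_zero P)]
  · rw [← Finset.sum_fn]
    exact eLpNorm_sum_le hmeas hq

theorem eLpNorm_sub_estimator_lt (hq : 1 ≤ q) (hy : y 0 = 0)
    (hξ : ∀ l ∈ Finset.Icc 1 L, ∀ j, AEStronglyMeasurable (ξ l j) P) {d : ℕ → ℝ} {ε : ℝ}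
    (hd : ∀ l ∈ Finset.Icc 1 L, 0 ≤ d l)
    (hlevel : ∀ l ∈ Finset.Icc 1 L, eLpNorm (fun ω =>
      (1 / (M l : ℝ)) • ∑ j ∈ Finset.range (M l), ξ l j ω - (y l - y (l - 1))) q P ≤
        ENNReal.ofReal (d l))
    (hsum : ‖x - y L‖ + ∑ l ∈ Finset.Icc 1 L, d l < ε) :
    eLpNorm (fun ω => x - estimator ξ L M ω) q P < ENNReal.ofReal ε := by
  have hd0 : 0 ≤ ∑ l ∈ Finset.Icc 1 L, d l := Finset.sum_nonneg hd
  have hε : 0 < ε := (add_nonneg (norm_nonneg _) hd0).trans_lt hsum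
  calc eLpNorm (fun ω => x - estimator ξ L M ω) q P
    _ ≤ ‖x - y L‖ₑ + ∑ l ∈ Finset.Icc 1 L, ENNReal.ofReal (d l) :=
        (eLpNorm_sub_estimator_le hq hy hξ).trans
          (add_le_add_right (Finset.sum_le_sum hlevel) _)
    _ = ENNReal.ofReal (‖x - y L‖ + ∑ l ∈ Finset.Icc 1 L, d l) := by
        rw [ENNReal.ofReal_add (norm_nonneg _) hd0, ofReal_norm, ENNReal.ofReal_sum_of_nonneg hd]
    _ < ENNReal.ofReal ε := (ENNReal.ofReal_lt_ofReal_iff hε).2 hsum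

end Error

lemma rpow_le_max_mul_rpow {c₁ c₂ x N : ℝ} (hc₁ : 0 < c₁) (hx : 0 < x) (h₁ : c₁ * x ≤ N)
    (h₂ : N ≤ c₂ * x) (a : ℝ) : N ^ a ≤ max (c₁ ^ a) (c₂ ^ a) * x ^ a := by
  have hc₂ : 0 < c₂ := hc₁.trans_le (le_of_mul_le_mul_right (h₁.trans h₂) hx)
  have hN : 0 < N := (mul_pos hc₁ hx).trans_le h₁
  rcases le_total 0 a with ha | ha
  · calc N ^ a ≤ (c₂ * x) ^ a := Real.rpow_le_rpow hN.le h₂ ha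
      _ = c₂ ^ a * x ^ a := Real.mul_rpow hc₂.le hx.le
      _ ≤ _ := by gcongr; exact le_max_right _ _
  · calc N ^ a ≤ (c₁ * x) ^ a := Real.rpow_le_rpow_of_nonpos (mul_pos hc₁ hx) h₁ ha
      _ = c₁ ^ a * x ^ a := Real.mul_rpow hc₁.le hx.le
      _ ≤ _ := by gcongr; exact le_max_left _ _

end MLMC

end

theorem mainTheorem5_general
    (p : ℝ≥0∞) [Fact (1 ≤ p)] (r : ℝ) (hr1 : 1 < r) (hr2 : r ≤ 2) (hpr : p ≤ ENNReal.ofReal r)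
    (α b γ Cα Cβ Cγ A c₁ c₂ : ℝ) (hα : 0 < α) (hγ : 0 < γ)
    (hCα : 0 < Cα) (hCβ : 0 < Cβ) (hCγ : 0 < Cγ) (hA : 1 < A) (hc₁ : 0 < c₁) :
    ∃ K : ℝ, 0 < K ∧
      ∀ (S : Type u) [MeasurableSpace S] (μ : Measure S) [SigmaFinite μ]
        (Ω : Type v) [MeasurableSpace Ω] (P : Measure Ω) [IsProbabilityMeasure P]
        [MeasurableSpace (Lp ℝ p μ)] [BorelSpace (Lp ℝ p μ)]
        (x : Lp ℝ p μ) (Xl : ℕ → Ω → Lp ℝ p μ) (_ : Xl 0 = 0)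
        (_ : ∀ l, 1 ≤ l → Integrable (Xl l) P)
        (N cost : ℕ → ℝ)
        (_ : ∀ l, 1 ≤ l → c₁ * A ^ l ≤ N l ∧ N l ≤ c₂ * A ^ l)
        (_ : ∀ l, 1 ≤ l → ‖x - ∫ ω, Xl l ω ∂P‖ ≤ Cα * N l ^ (-α))
        (_ : ∀ l, 1 ≤ l → MLMC.swapNorm P (ENNReal.ofReal r)
            (fun ω => Xl l ω - (∫ ω', Xl l ω' ∂P) - (Xl (l - 1) ω - ∫ ω', Xl (l - 1) ω' ∂P))
            ≤ ENNReal.ofReal (Cβ * N l ^ (-b)))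
        (_ : ∀ l, 1 ≤ l → cost l ≤ Cγ * N l ^ γ)
        (ξ : ℕ → ℕ → Ω → Lp ℝ p μ)
        (_ : ∀ l, 1 ≤ l → ∀ j, MLMC.MemSwap P (ENNReal.ofReal r) (ξ l j))
        (_ : ∀ l, 1 ≤ l → iIndepFun (ξ l) P)
        (_ : ∀ l, 1 ≤ l → ∀ j, IdentDistrib (ξ l j) (fun ω => Xl l ω - Xl (l - 1) ω) P P)
        (ε : ℝ) (_ : ε ∈ Set.Ioc (0 : ℝ) (1 / 2)),
        ∃ (L : ℕ) (M : ℕ → ℕ), 1 ≤ L ∧ (∀ l ∈ Finset.Icc 1 L, 1 ≤ M l) ∧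
          (∀ q ≤ ENNReal.ofReal r,
            eLpNorm (fun ω => x - MLMC.estimator ξ L M ω) q P < ENNReal.ofReal ε) ∧
          MLMC.totalCost cost L M ≤ K * MLMC.costOrder α b γ A (Real.conjExponent r) ε := by
  have hσ := Real.HolderConjugate.conjExponent hr1
  have hmax (a : ℝ) : 0 < max (c₁ ^ a) (c₂ ^ a) := lt_max_of_lt_left (Real.rpow_pos_of_pos hc₁ a)
  obtain ⟨K, hK, hlevels⟩ := MLMC.exists_levels_sampleSizes (b := b) hA hα hγ hσ.symm.pos
    (mul_pos hCα (hmax (-α)))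
    (mul_pos (Real.rpow_pos_of_pos two_pos r⁻¹) (mul_pos hCβ (hmax (-b))))
    (mul_pos hCγ (hmax γ))
  refine ⟨K, hK, ?_⟩
  intro S _ μ _ Ω _ P _ _ _ x Xl hX0 hXl N cost hN hbias hstrong hcost ξ hξ hindep hident ε hε
  obtain ⟨L, M, hL, hM, hbiasL, herror, hcostL⟩ := hlevels ε hε
  have hrate {C : ℝ} (hC : 0 < C) (a : ℝ) (l : ℕ) (hl : 1 ≤ l) :
      C * N l ^ a ≤ C * max (c₁ ^ a) (c₂ ^ a) * (A ^ l) ^ a := by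
    rw [mul_assoc]
    exact mul_le_mul_of_nonneg_left (MLMC.rpow_le_max_mul_rpow hc₁
      (pow_pos (zero_lt_one.trans hA) l) (hN l hl).1 (hN l hl).2 a) hC.le
  have hint (l : ℕ) : Integrable (Xl l) P := by
    rcases l.eq_zero_or_pos with rfl | hl
    · exact hX0 ▸ integrable_zero _ _ _
    · exact hXl l hl
  have hmeas : ∀ l ∈ Finset.Icc 1 L, ∀ j, AEStronglyMeasurable (ξ l j) P := fun l hl j =>
    (hident l (Finset.mem_Icc.1 hl).1 j).aestronglyMeasurable_iff.2
      ((hint l).sub (hint (l - 1))).aestronglyMeasurable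
  refine ⟨L, M, hL, hM, fun q hq => ?_, ?_⟩
  · refine (eLpNorm_le_eLpNorm_of_exponent_le hq
      (aestronglyMeasurable_const.sub (MLMC.aestronglyMeasurable_estimator hmeas))).trans_lt ?_
    refine MLMC.eLpNorm_sub_estimator_lt (y := fun l => ∫ ω, Xl l ω ∂P)
      (ENNReal.one_le_ofReal.2 hr1.le) (by simp [hX0]) hmeas
      (d := fun l => 2 ^ r⁻¹ * (Cβ * max (c₁ ^ (-b)) (c₂ ^ (-b))) * (A ^ l) ^ (-b) *
        (M l : ℝ) ^ (-(Real.conjExponent r)⁻¹)) (fun l _ => by positivity) (fun l hl => ?_)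
      (by linarith [hbias L hL, hrate hCα (-α) L hL])
    have hl1 := (Finset.mem_Icc.1 hl).1
    rw [← hσ.one_sub_inv, neg_sub, mul_assoc (2 ^ r⁻¹)]
    exact MLMC.eLpNorm_sampleMean_sub_integral_sub_le hr1.le hr2 hpr (hindep l hl1)
      (hident l hl1) (hint l) (hint (l - 1)) (hξ l hl1) (Nat.one_le_iff_ne_zero.1 (hM l hl))
      ((hstrong l hl1).trans (ENNReal.ofReal_le_ofReal (hrate hCβ (-b) l hl1)))
  · refine (Finset.sum_le_sum fun l hl => ?_).trans hcostL
    have hl1 := (Finset.mem_Icc.1 hl).1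
    exact mul_le_mul_of_nonneg_right ((hcost l hl1).trans (hrate hCγ γ l hl1)) (Nat.cast_nonneg _)

theorem mainTheorem5
    (p : ℝ≥0∞) [Fact (1 ≤ p)] (q qt : ℝ) (hq1 : 1 < q) (hq2 : q < 2)
    (hpq : p ≤ ENNReal.ofReal q) (hqt : q ≤ qt)
    (β : ℝ → ℝ) (hβ : ∀ r ∈ Set.Icc q (min qt 2), 0 < β r)
    (α γ Cα Cβ Cγ A c₁ c₂ : ℝ) (hα : 0 < α) (hγ : 0 < γ)
    (hCα : 0 < Cα) (hCβ : 0 < Cβ) (hCγ : 0 < Cγ) (hA : 1 < A) (hc₁ : 0 < c₁) (hc₂ : 0 < c₂)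
    (r : ℝ) (hr : r ∈ Set.Icc q (min qt 2)) :
    -- the constant depends only on the parameters above
    ∃ K : ℝ, 0 < K ∧
      ∀ (S : Type u) [MeasurableSpace S] (μ : Measure S) [SigmaFinite μ]
        (_ : MLMC.ApproxByAveraging.{u, v} μ)
        (Ω : Type v) [MeasurableSpace Ω] (P : Measure Ω) [IsProbabilityMeasure P]
        [MeasurableSpace (Lp ℝ p μ)] [BorelSpace (Lp ℝ p μ)]
        (X : Ω → Lp ℝ p μ) (_ : MemLp X 1 P)
        -- the approximations `X_ℓ`, `ℓ ≥ 1`, with the convention `X_0 = 0`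
        (Xl : ℕ → Ω → Lp ℝ p μ) (_ : Xl 0 = 0)
        (_ : ∀ l, 1 ≤ l → MemLp (Xl l) (ENNReal.ofReal qt) P ∧
          MLMC.MemSwap P (ENNReal.ofReal qt) (Xl l))
        (N cost : ℕ → ℝ)
        (_ : ∀ l, 1 ≤ l → c₁ * A ^ l ≤ N l ∧ N l ≤ c₂ * A ^ l)
        (_ : ∀ l, 1 ≤ l → ‖(∫ ω, X ω ∂P) - ∫ ω, Xl l ω ∂P‖ ≤ Cα * N l ^ (-α))
        (_ : ∀ ρ ∈ Set.Icc q (min qt 2), ∀ l, 1 ≤ l →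
          MLMC.swapNorm P (ENNReal.ofReal ρ)
            (fun ω => Xl l ω - (∫ ω', Xl l ω' ∂P) - (Xl (l - 1) ω - ∫ ω', Xl (l - 1) ω' ∂P))
            ≤ ENNReal.ofReal (Cβ * N l ^ (-β ρ)))
        (_ : ∀ l, 1 ≤ l → cost l ≤ Cγ * N l ^ γ)
        -- independent copies `ξ_{ℓ,j}` of `ξ_ℓ = X_ℓ - X_{ℓ-1}`
        (ξ : ℕ → ℕ → Ω → Lp ℝ p μ)
        (_ : ∀ l, 1 ≤ l → ∀ j, MemLp (ξ l j) (ENNReal.ofReal qt) P ∧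
          MLMC.MemSwap P (ENNReal.ofReal qt) (ξ l j))
        (_ : ∀ l, 1 ≤ l → iIndepFun (ξ l) P)
        (_ : ∀ l, 1 ≤ l → ∀ j, IdentDistrib (ξ l j) (fun ω => Xl l ω - Xl (l - 1) ω) P P)
        (ε : ℝ) (_ : ε ∈ Set.Ioc (0 : ℝ) (1 / 2)),
        ∃ (L : ℕ) (M : ℕ → ℕ), 1 ≤ L ∧ (∀ l ∈ Finset.Icc 1 L, 1 ≤ M l) ∧
          eLpNorm (fun ω => (∫ ω', X ω' ∂P) - MLMC.estimator ξ L M ω) (ENNReal.ofReal q) P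
            < ENNReal.ofReal ε ∧
          MLMC.totalCost cost L M ≤ K * MLMC.costOrder α (β r) γ A (Real.conjExponent r) ε := by
  have hqr : q ≤ r := hr.1
  obtain ⟨hrqt, hr2⟩ := le_min_iff.1 hr.2
  have hle : ENNReal.ofReal r ≤ ENNReal.ofReal qt := ENNReal.ofReal_le_ofReal hrqt
  have : Fact (1 ≤ ENNReal.ofReal r) := ⟨ENNReal.one_le_ofReal.2 (hq1.le.trans hqr)⟩
  obtain ⟨K, hK, hgeneral⟩ := mainTheorem5_general p r (hq1.trans_le hqr) hr2
    (hpq.trans (ENNReal.ofReal_le_ofReal hqr)) α (β r) γ Cα Cβ Cγ A c₁ c₂ hα hγ hCα hCβ hCγ hA hc₁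
  refine ⟨K, hK, ?_⟩
  intro S _ μ _ _ Ω _ P _ _ _ X _ Xl hX0 hXl N cost hN hbias hstrong hcost ξ hξ hindep hident ε hε
  obtain ⟨L, M, hL, hM, herror, htotal⟩ := hgeneral S μ Ω P (∫ ω, X ω ∂P) Xl hX0
    (fun l hl => (hXl l hl).1.integrable (this.out.trans hle)) N cost hN hbias (hstrong r hr)
    hcost ξ (fun l hl j => ⟨this, (hξ l hl j).2.exists_isSwap_of_le hle⟩) hindep hident ε hε
  exact ⟨L, M, hL, hM, herror _ (ENNReal.ofReal_le_ofReal hqr), htotal⟩
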